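/- There is an absolute constant $\varepsilon_0\in(0,1)$ such that for every integer $k\ge 1$ and every $K>0$ there is a constant $c=c(k,K)>0$ with the following property. For every integer $n\ge 2$ and every $0<\varepsilon\le\varepsilon_0$ with $$\varepsilon\,\log^k\tfrac1\varepsilon\ \ge\ \frac{K}{n^2}$$ (that is, $\varepsilon=\tilde\Omega(1/n^2)$), there is a set $P$ of $n$ points in $\mathbb{R}^2$ such that every Steiner $(1+\varepsilon)$-spanner for $P$ has at least $$c\cdot\frac{n}{\sqrt{\varepsilon\log^k(1/\varepsilon)}}$$ edges and lightness at least $$c\cdot\frac{1}{\varepsilon\log^k(1/\varepsilon)}.$$ In particular ($k=1$), if $\varepsilon\log\frac1\varepsilon=\Omega(1/n^2)$, then the bounds are $\Omega\bigl(n/\sqrt{\varepsilon\log(1/\varepsilon)}\bigr)$ edges and lightness $\Omega\bigl(1/(\varepsilon\log(1/\varepsilon))\bigr)$. Here a Steiner $t$-spanner for a finite set $P\subset\mathbb{R}^2$ is a finite graph whose vertex set is a finite set of points of $\mathbb{R}^2$ containing $P$ (the other vertices are the Steiner points), whose edges are weighted by the Euclidean distance of their endpoints, and in which any two points $x,y\in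 P$ are at weighted graph distance at most $t\,|xy|$. Its lightness is the sum of the weights of all its edges divided by the weight of a Euclidean minimum spanning tree of $P$. -/

import Mathlib

open scoped ENNReal

namespace EuclidSpanner

/-- The Euclidean plane. -/
abbrev Plane : Type := EuclideanSpace ℝ (Fin 2)

/-- The length of the (unordered) pair `s(x, y)`: the distance between `x` and `y`. -/
noncomputable def edgeLength {V : Type} [PseudoEMetricSpace V] : Sym2 V → ℝ≥0∞ :=
  Sym2.lift ⟨fun x y => edist x y, fun x y => edist_comm x y⟩

/-- The weight of a graph on points of a metric space: the sum of the lengths of its edges. -/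
noncomputable def weight {V : Type} [PseudoEMetricSpace V] (G : SimpleGraph V) : ℝ≥0∞ :=
  ∑' e : G.edgeSet, edgeLength (e : Sym2 V)

/-- The length of a walk: the sum of the lengths of its edges, with multiplicity. -/
noncomputable def walkLength {V : Type} [PseudoEMetricSpace V] {G : SimpleGraph V} {x y : V}
    (p : G.Walk x y) : ℝ≥0∞ :=
  (p.edges.map edgeLength).sum

/-- The weighted distance between `x` and `y` in `G` (it is `⊤` if they are not connected). -/
noncomputable def graphDist {V : Type} [PseudoEMetricSpace V] (G : SimpleGraph V) (x y : V) :
    ℝ≥0∞ :=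
  ⨅ p : G.Walk x y, walkLength p

/-- `G` is a Steiner `t`-spanner for the finite point set `P` in the plane: a finite graph, with
straight edges between points of the plane, in which any two points `x, y` of `P` have distance at
most `t * |xy|`. Its vertices are the points of `P` and the end points of the edges; those that are
not in `P` are the Steiner points (the other points of the plane, isolated in `G`, are not
counted as vertices). -/
def IsSteinerSpanner (P : Finset Plane) (t : ℝ) (G : SimpleGraph Plane) : Prop :=
  G.edgeSet.Finite ∧
    ∀ x ∈ P, ∀ y ∈ P, graphDist G x y ≤ ENNReal.ofReal t * edist x y

/-- The weight of a minimum spanning tree of `P`: the least weight of a tree with vertex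
set `P`. -/
noncomputable def mstWeight (P : Finset Plane) : ℝ≥0∞ :=
  ⨅ T : {T : SimpleGraph P // T.IsTree}, weight T.1

/-- The lightness of `G` with respect to `P`: its weight divided by the weight of a minimum
spanning tree of `P`. -/
noncomputable def lightness (P : Finset Plane) (G : SimpleGraph Plane) : ℝ≥0∞ :=
  weight G / mstWeight P

end EuclidSpanner

namespace EuclidSpanner

/-! Put the points on two vertical columns one unit apart, at spacing `1/m`. There are at least `n *
m / 4` rungs across with slope in `[0, 1)`, and any two differ in slope or in height by a multiple
of `1/m`, which is at least `100 * √ε`.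

A `(1 + ε)`-path along a rung stays in a strip of width `O(√ε)`, and at least length `1/2` of it
makes an angle `O(√ε)` with the rung, since other edges lose too much progress
(`exists_aligned_edges`). Direction and position of such an edge determine the rung, so distinct
rungs use disjoint edge sets (`ladder_spanner_bounds`). This forces `n * m / 4` edges and weight `n
* m / 8`, against a spanning tree of weight at most `2 * n / m`: lightness `m ^ 2 / 16`. It remains
to choose `m`. -/

theorem weight_mono {V : Type} [PseudoEMetricSpace V] {G H : SimpleGraph V} (h : G ≤ H) :
    weight G ≤ weight H :=
  ENNReal.tsum_mono_subtype edgeLength (SimpleGraph.edgeSet_mono h)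

theorem sum_edgeLength_le_weight {V : Type} [PseudoEMetricSpace V] {G : SimpleGraph V}
    {F : Finset (Sym2 V)} (h : (F : Set (Sym2 V)) ⊆ G.edgeSet) :
    ∑ e ∈ F, edgeLength e ≤ weight G := by
  rw [← Finset.tsum_subtype]
  exact ENNReal.tsum_mono_subtype edgeLength h

@[simp] theorem edgeLength_mk {V : Type} [PseudoEMetricSpace V] (x y : V) :
    edgeLength s(x, y) = edist x y := rfl

/-- The minimum spanning tree is no heavier than a path through all the points. -/
theorem mstWeight_image_le [DecidableEq Plane] (f : ℕ → Plane) {n : ℕ} (hn : 1 ≤ n) :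
    mstWeight ((Finset.range n).image f) ≤ ∑ k ∈ Finset.range (n - 1), edist (f k) (f (k + 1)) := by
  classical
  set P := (Finset.range n).image f with hP
  have hmem : ∀ k : Fin n, f k ∈ P := fun k =>
    Finset.mem_image_of_mem f (Finset.mem_range.2 k.2)
  let g : Fin n → P := fun k => ⟨f k, hmem k⟩
  let E : Fin (n - 1) → Sym2 P := fun k => s(g ⟨k, by omega⟩, g ⟨k + 1, by omega⟩)
  let H : SimpleGraph P := SimpleGraph.fromEdgeSet (Set.range E)
  have hreach : ∀ k : ℕ, ∀ hk : k < n, H.Reachable (g ⟨0, by omega⟩) (g ⟨k, hk⟩) := by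
    intro k
    induction k with
    | zero => intro hk; exact SimpleGraph.Reachable.refl _
    | succ k ih =>
      intro hk
      refine (ih (by omega)).trans ?_
      -- `f` need not be injective: a repeated point gives a loop, which `fromEdgeSet` drops.
      by_cases h : g ⟨k, by omega⟩ = g ⟨k + 1, hk⟩
      · rw [h]
      · refine SimpleGraph.Adj.reachable ?_
        rw [SimpleGraph.fromEdgeSet_adj]
        exact ⟨⟨⟨k, by omega⟩, rfl⟩, h⟩
  have hsurj : ∀ p : P, ∃ k : ℕ, ∃ hk : k < n, p = g ⟨k, hk⟩ := by
    rintro ⟨p, hp⟩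
    obtain ⟨k, hk, rfl⟩ := Finset.mem_image.1 hp
    exact ⟨k, Finset.mem_range.1 hk, rfl⟩
  have hconn : H.Connected := by
    have : Nonempty P := ⟨g ⟨0, by omega⟩⟩
    refine SimpleGraph.Connected.mk ?_
    intro p q
    obtain ⟨k, hk, rfl⟩ := hsurj p
    obtain ⟨l, hl, rfl⟩ := hsurj q
    exact (hreach k hk).symm.trans (hreach l hl)
  obtain ⟨T, hTH, hT⟩ := hconn.exists_isTree_le
  calc mstWeight P ≤ weight T := iInf_le (fun T : {T : SimpleGraph P // T.IsTree} => weight T.1)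
        ⟨T, hT⟩
    _ ≤ weight H := weight_mono hTH
    _ ≤ ∑' e : Set.range E, edgeLength (e : Sym2 P) :=
        ENNReal.tsum_mono_subtype edgeLength (by
          rw [SimpleGraph.edgeSet_fromEdgeSet]; exact Set.sdiff_subset)
    _ ≤ ∑' k : Fin (n - 1), edgeLength (E k) :=
        ENNReal.tsum_le_tsum_comp_of_surjective (Set.rangeFactorization_surjective (f := E))
          (fun e : Set.range E => edgeLength (e : Sym2 P))
    _ = ∑ k ∈ Finset.range (n - 1), edist (f k) (f (k + 1)) := by
        rw [tsum_fintype, ← Fin.sum_univ_eq_sum_range (fun k => edist (f k) (f (k + 1)))]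
        rfl

/-! ### Lengths of walks -/

theorem walkLength_cons {V : Type} [PseudoEMetricSpace V] {G : SimpleGraph V} {x y z : V}
    (h : G.Adj x y) (p : G.Walk y z) :
    walkLength (SimpleGraph.Walk.cons h p) = edist x y + walkLength p := by
  simp [walkLength]

theorem walkLength_append {V : Type} [PseudoEMetricSpace V] {G : SimpleGraph V} {x y z : V}
    (p : G.Walk x y) (q : G.Walk y z) :
    walkLength (p.append q) = walkLength p + walkLength q := by
  simp [walkLength]

theorem edist_le_walkLength {V : Type} [PseudoEMetricSpace V] {G : SimpleGraph V} {x y : V}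
    (p : G.Walk x y) : edist x y ≤ walkLength p := by
  induction p with
  | nil => simp
  | cons h p ih =>
    rw [walkLength_cons]
    exact (edist_triangle _ _ _).trans (by gcongr)

theorem edist_add_edist_le_walkLength {V : Type} [PseudoEMetricSpace V] {G : SimpleGraph V}
    {x y v : V} (p : G.Walk x y) (hv : v ∈ p.support) :
    edist x v + edist v y ≤ walkLength p := by
  classical
  rw [← p.take_spec hv, walkLength_append]
  exact add_le_add (edist_le_walkLength _) (edist_le_walkLength _)

theorem walkLength_eq_ofReal {G : SimpleGraph Plane} {x y : Plane} (p : G.Walk x y) :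
    walkLength p = ENNReal.ofReal ((p.edges.map fun e => (edgeLength e).toReal).sum) := by
  induction p with
  | nil => simp [walkLength]
  | cons h p ih =>
    rw [walkLength_cons, ih]
    simp only [SimpleGraph.Walk.edges_cons, List.map_cons, List.sum_cons, edgeLength_mk,
      edist_dist]
    rw [ENNReal.toReal_ofReal dist_nonneg, ENNReal.ofReal_add dist_nonneg]
    exact List.sum_nonneg (by simp)

theorem dist_sq_plane (x y : Plane) :
    dist x y ^ 2 = (y 0 - x 0) ^ 2 + (y 1 - x 1) ^ 2 := by
  rw [dist_comm, EuclideanSpace.dist_eq, Real.sq_sqrt (by positivity)]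
  simp [Fin.sum_univ_two, Real.dist_eq, sq_abs]

/-! ### Short paths follow the segment they approximate -/

/-- The edge `e` makes an angle with the lines of slope `s` that is small in terms of `κ`. -/
def IsAligned (s κ : ℝ) (e : Sym2 Plane) : Prop :=
  ∃ x y : Plane, e = s(x, y) ∧ |(y 1 - x 1) - s * (y 0 - x 0)| ≤ κ * dist x y

theorem isAligned_mk {s κ : ℝ} {x y : Plane} :
    IsAligned s κ s(x, y) ↔ |(y 1 - x 1) - s * (y 0 - x 0)| ≤ κ * dist x y := by
  constructor
  · rintro ⟨x', y', he, h⟩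
    rcases Sym2.eq_iff.1 he with ⟨rfl, rfl⟩ | ⟨rfl, rfl⟩
    · exact h
    · rw [dist_comm, ← abs_neg]
      convert h using 2
      ring
  · exact fun h => ⟨x, y, rfl, h⟩

/-- The progress that an edge makes in the direction `(1, s)` is at most its length. -/
theorem progress_le (s : ℝ) (x y : Plane) :
    (y 0 - x 0) + s * (y 1 - x 1) ≤ √(1 + s ^ 2) * dist x y := by
  refine le_of_sq_le_sq ?_ (by positivity)
  rw [mul_pow, Real.sq_sqrt (by positivity), dist_sq_plane]
  nlinarith [sq_nonneg ((y 1 - x 1) - s * (y 0 - x 0))]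

/-- An edge that is not aligned makes less progress in the direction `(1, s)`. -/
theorem progress_le_of_not_isAligned {s κ : ℝ} (hs : |s| ≤ 1) (hκ : 0 ≤ κ) (hκ' : κ ≤ 1)
    {x y : Plane} (h : ¬ IsAligned s κ s(x, y)) :
    (y 0 - x 0) + s * (y 1 - x 1) ≤ √(1 + s ^ 2) * ((1 - κ ^ 2 / 4) * dist x y) := by
  rw [isAligned_mk, not_le] at h
  have hκ2 : κ ^ 2 ≤ 1 := by nlinarith
  have hs2 : s ^ 2 ≤ 1 := (sq_le_one_iff_abs_le_one s).2 hs
  have hd := dist_sq_plane x y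
  have h0 : (κ * dist x y) ^ 2 ≤ ((y 1 - x 1) - s * (y 0 - x 0)) ^ 2 := by
    rw [← sq_abs ((y 1 - x 1) - s * (y 0 - x 0))]
    exact pow_le_pow_left₀ (by positivity) h.le 2
  refine le_of_sq_le_sq ?_ (mul_nonneg (by positivity) (mul_nonneg (by linarith) dist_nonneg))
  rw [mul_pow, Real.sq_sqrt (by positivity), mul_pow]
  -- Progress and deviation are orthogonal components: their squares add up to `(1 + s ^ 2) * dist x
  -- y ^ 2`.
  have h1 : ((y 0 - x 0) + s * (y 1 - x 1)) ^ 2 ≤ (1 + s ^ 2 - κ ^ 2) * dist x y ^ 2 := by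
    rw [mul_pow] at h0
    rw [sub_mul, hd] at *
    nlinarith
  have h2 : 1 + s ^ 2 - κ ^ 2 ≤ (1 + s ^ 2) * (1 - κ ^ 2 / 4) ^ 2 := by
    nlinarith [mul_nonneg (sub_nonneg.2 hs2) (sq_nonneg κ), mul_nonneg (sq_nonneg s) (sq_nonneg (κ ^ 2)),
      sq_nonneg (κ ^ 2)]
  calc _ ≤ _ := h1
    _ ≤ _ := mul_le_mul_of_nonneg_right h2 (sq_nonneg _)
    _ = _ := by ring

-- Progress telescopes along the walk; aligned edges get back the fraction `κ ^ 2 / 4` that the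
-- others lose.
open Classical in
theorem progress_walk_le {s κ : ℝ} (hs : |s| ≤ 1) (hκ : 0 ≤ κ) (hκ' : κ ≤ 1)
    {G : SimpleGraph Plane} {x y : Plane} (p : G.Walk x y) :
    (y 0 - x 0) + s * (y 1 - x 1) ≤ √(1 + s ^ 2) *
      ((1 - κ ^ 2 / 4) * (p.edges.map fun e => (edgeLength e).toReal).sum +
        κ ^ 2 / 4 * ((p.edges.filter fun e => IsAligned s κ e).map
          fun e => (edgeLength e).toReal).sum) := by
  induction p with
  | nil => simp
  | @cons x y z h p ih =>
    rw [SimpleGraph.Walk.edges_cons, List.map_cons, List.sum_cons, List.filter_cons]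
    by_cases ha : IsAligned s κ s(x, y)
    · have := progress_le s x y
      simp only [ha, decide_true, if_true, List.map_cons, List.sum_cons, edgeLength_mk, edist_dist,
        ENNReal.toReal_ofReal dist_nonneg]
      linarith
    · have := progress_le_of_not_isAligned hs hκ hκ' ha
      simp only [ha, decide_false, if_false, edgeLength_mk, edist_dist, Bool.false_eq_true,
        ENNReal.toReal_ofReal dist_nonneg]
      linarith

/-- A point of an ellipse with foci `a` and `b` is close to the line through `a` and `b`. -/
theorem abs_sub_le_of_dist_add_dist_le {s ε : ℝ} (hs : |s| ≤ 1) (hε : 0 < ε) (hε' : ε ≤ 1)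
    {a b v : Plane} (h0 : b 0 - a 0 = 1) (h1 : b 1 - a 1 = s)
    (h : dist a v + dist v b ≤ (1 + 2 * ε) * √(1 + s ^ 2)) :
    |(v 1 - a 1) - s * (v 0 - a 0)| ≤ 3 * √ε := by
  have hs2 : s ^ 2 ≤ 1 := (sq_le_one_iff_abs_le_one s).2 hs
  have e1 := dist_sq_plane a v
  have e2 := dist_sq_plane v b
  obtain ⟨r, hr⟩ : ∃ r, r = √(1 + s ^ 2) := ⟨_, rfl⟩
  have hr2 : r ^ 2 = 1 + s ^ 2 := by rw [hr, Real.sq_sqrt (by positivity)]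
  have hr0 : 0 ≤ r := by rw [hr]; positivity
  rw [← hr] at h
  obtain ⟨ψ, hψ⟩ : ∃ ψ, ψ = (v 1 - a 1) - s * (v 0 - a 0) := ⟨_, rfl⟩
  obtain ⟨p, hp⟩ : ∃ p, p = (v 0 - a 0) + s * (v 1 - a 1) := ⟨_, rfl⟩
  obtain ⟨q, hq⟩ : ∃ q, q = (b 0 - v 0) + s * (b 1 - v 1) := ⟨_, rfl⟩
  have hpq : p + q = r ^ 2 := by rw [hp, hq, hr2]; linear_combination h0 + s * h1
  obtain ⟨X, hX⟩ : ∃ X, X = r * dist a v := ⟨_, rfl⟩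
  obtain ⟨Y, hY⟩ : ∃ Y, Y = r * dist v b := ⟨_, rfl⟩
  have hX0 : 0 ≤ X := by rw [hX]; positivity
  have hY0 : 0 ≤ Y := by rw [hY]; positivity
  have hX2 : X ^ 2 = p ^ 2 + ψ ^ 2 := by rw [hX, mul_pow, e1, hr2, hp, hψ]; ring
  have hY2 : Y ^ 2 = q ^ 2 + ψ ^ 2 := by
    have : ψ = -((b 1 - v 1) - s * (b 0 - v 0)) := by
      rw [hψ]; linear_combination h1 - s * h0
    rw [hY, mul_pow, e2, hr2, hq, this]; ring
  -- Cauchy–Schwarz for `(p, ψ)` and `(q, ψ)`; hence `(X + Y) ^ 2 ≥ (p + q) ^ 2 + 4 * ψ ^ 2`.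
  have hXY : p * q + ψ ^ 2 ≤ X * Y := by
    refine le_of_sq_le_sq ?_ (by positivity)
    rw [mul_pow, hX2, hY2]
    have e3 : (p ^ 2 + ψ ^ 2) * (q ^ 2 + ψ ^ 2) - (p * q + ψ ^ 2) ^ 2 = (ψ * (p - q)) ^ 2 := by ring
    have := sq_nonneg (ψ * (p - q))
    linarith
  have hsum : X + Y ≤ (1 + 2 * ε) * r ^ 2 := by
    rw [hX, hY, ← mul_add]
    exact (mul_le_mul_of_nonneg_left h hr0).trans_eq (by ring)
  have hsq : (X + Y) ^ 2 ≤ ((1 + 2 * ε) * r ^ 2) ^ 2 := pow_le_pow_left₀ (by positivity) hsum 2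
  have h4 : 4 * ψ ^ 2 ≤ (4 * ε + 4 * ε ^ 2) * (r ^ 2) ^ 2 := by
    have e3 : (p + q) ^ 2 = (r ^ 2) ^ 2 := by rw [hpq]
    have e4 : (X + Y) ^ 2 = X ^ 2 + 2 * (X * Y) + Y ^ 2 := by ring
    have e5 : (p + q) ^ 2 = p ^ 2 + 2 * (p * q) + q ^ 2 := by ring
    have e6 : ((1 + 2 * ε) * r ^ 2) ^ 2 = (r ^ 2) ^ 2 + (4 * ε + 4 * ε ^ 2) * (r ^ 2) ^ 2 := by ring
    linarith
  have hr4 : (r ^ 2) ^ 2 ≤ 4 := by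
    have : (r ^ 2) ^ 2 ≤ 2 ^ 2 := pow_le_pow_left₀ (sq_nonneg r) (by linarith) 2
    linarith
  rw [← hψ]
  refine abs_le_of_sq_le_sq ?_ (by positivity)
  rw [mul_pow, Real.sq_sqrt hε.le]
  have : (4 * ε + 4 * ε ^ 2) * (r ^ 2) ^ 2 ≤ (4 * ε + 4 * ε ^ 2) * 4 := by gcongr
  have : ε ^ 2 ≤ ε := by rw [sq]; exact mul_le_of_le_one_left hε.le hε'
  norm_num
  linarith

/-- The edges of a short path between the points `a` and `b`, one unit apart horizontally, that
are aligned with `ab` have total length at least `1 / 2`, and lie close to the line `ab`. -/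
theorem exists_aligned_edges {P : Finset Plane} {G : SimpleGraph Plane} {ε s : ℝ} (hε : 0 < ε)
    (hε' : ε ≤ 1 / 10000) (hs : |s| ≤ 1) (hG : IsSteinerSpanner P (1 + ε) G) {a b : Plane}
    (ha : a ∈ P) (hb : b ∈ P) (h0 : b 0 - a 0 = 1) (h1 : b 1 - a 1 = s) :
    ∃ F : Finset (Sym2 Plane), (F : Set (Sym2 Plane)) ⊆ G.edgeSet ∧
      ENNReal.ofReal (1 / 2) ≤ ∑ e ∈ F, edgeLength e ∧
      ∀ e ∈ F, IsAligned s (4 * √ε) e ∧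
        ∀ v ∈ e, |(v 1 - a 1) - s * (v 0 - a 0)| ≤ 3 * √ε := by
  classical
  obtain ⟨r, hr⟩ : ∃ r, r = √(1 + s ^ 2) := ⟨_, rfl⟩
  have hr2 : r ^ 2 = 1 + s ^ 2 := by rw [hr, Real.sq_sqrt (by positivity)]
  have hr1 : 1 ≤ r := by rw [hr]; exact Real.one_le_sqrt.2 (by nlinarith [sq_nonneg s])
  have hd : dist a b = r := by
    rw [← Real.sqrt_sq (dist_nonneg (x := a) (y := b)), dist_sq_plane, h0, h1, hr, one_pow]
  -- `graphDist` is an infimum; relaxing `ε` to `2 * ε` makes the bound strict and yields an actual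
  -- walk.
  have hlt : graphDist G a b < ENNReal.ofReal ((1 + 2 * ε) * r) := by
    refine (hG.2 a ha b hb).trans_lt ?_
    rw [edist_dist, hd, ← ENNReal.ofReal_mul (by linarith)]
    exact (ENNReal.ofReal_lt_ofReal_iff (by positivity)).2 (by nlinarith)
  obtain ⟨p', hp'⟩ := iInf_lt_iff.1 hlt
  obtain ⟨p, hp⟩ : ∃ p : G.Walk a b, p = p'.bypass := ⟨_, rfl⟩
  have hpath : p.edges.Nodup := hp ▸ p'.bypass_isPath.isTrail.edges_nodup
  have hlen : walkLength p ≤ ENNReal.ofReal ((1 + 2 * ε) * r) := by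
    refine le_trans ?_ hp'.le
    rw [hp]
    exact (p'.edges_bypass_sublist_edges.map edgeLength).sum_le_sum (fun _ _ => zero_le)
  obtain ⟨W, hW⟩ : ∃ W, W = (p.edges.map fun e => (edgeLength e).toReal).sum := ⟨_, rfl⟩
  obtain ⟨A, hA⟩ : ∃ A, A = ((p.edges.filter fun e => IsAligned s (4 * √ε) e).map
    fun e => (edgeLength e).toReal).sum := ⟨_, rfl⟩
  have hWle : W ≤ (1 + 2 * ε) * r := by
    rw [walkLength_eq_ofReal, ← hW] at hlen
    exact (ENNReal.ofReal_le_ofReal_iff (by positivity)).1 hlen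
  have hsqrt : √ε ≤ 1 / 100 := by
    rw [Real.sqrt_le_left (by norm_num)]; norm_num; linarith
  have hprog := progress_walk_le hs (κ := 4 * √ε) (by positivity) (by linarith) p
  rw [← hW, ← hA, ← hr, h0, h1, mul_pow, Real.sq_sqrt hε.le] at hprog
  have hprog' : r ≤ (1 - 4 * ε) * W + 4 * ε * A := by
    have : r * r ≤ r * ((1 - 4 * ε) * W + 4 * ε * A) := by nlinarith
    exact le_of_mul_le_mul_left this (by linarith)
  have hrW : r ≤ W := by
    have := edist_le_walkLength p
    rw [walkLength_eq_ofReal, ← hW, edist_dist, hd] at this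
    refine (ENNReal.ofReal_le_ofReal_iff ?_).1 this
    rw [hW]
    exact List.sum_nonneg (by simp)
  -- With `κ = 4 * √ε` the loss rate is `4 * ε`, while the total excess is at most `2 * ε * r`; so
  -- the unaligned length `W - A` is at most `r / 2`.
  have hA2 : 1 / 2 ≤ A := by
    have : ε * (W - A) ≤ ε * (r / 2) := by nlinarith
    have := le_of_mul_le_mul_left this hε
    linarith
  refine ⟨(p.edges.filter fun e => IsAligned s (4 * √ε) e).toFinset, ?_, ?_, ?_⟩
  · intro e he
    simp only [List.coe_toFinset, List.mem_filter, Set.mem_ofPred_eq] at he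
    exact p.edges_subset_edgeSet he.1
  · rw [List.sum_toFinset _ (hpath.filter _)]
    refine (ENNReal.ofReal_le_ofReal hA2).trans ?_
    rw [hA]
    generalize p.edges.filter _ = l
    induction l with
    | nil => simp
    | cons e l ih =>
      simp only [List.map_cons, List.sum_cons]
      exact ENNReal.ofReal_add_le.trans (add_le_add ENNReal.ofReal_toReal_le ih)
  · intro e he
    simp only [List.mem_toFinset, List.mem_filter, decide_eq_true_eq] at he
    refine ⟨he.2, fun v hv => abs_sub_le_of_dist_add_dist_le hs hε (by linarith) h0 h1 ?_⟩
    have hvs : v ∈ p.support := by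
      obtain ⟨w, rfl⟩ := hv
      exact p.fst_mem_support_of_mem_edges he.1
    have := (edist_add_edist_le_walkLength p hvs).trans hlen
    rw [edist_dist, edist_dist, ← ENNReal.ofReal_add dist_nonneg dist_nonneg, hr] at this
    exact (ENNReal.ofReal_le_ofReal_iff (by positivity)).1 this

/-- Edges that are aligned with two slopes: the slopes are close to each other. -/
theorem abs_slope_sub_le {s s' κ : ℝ} (hs : |s| ≤ 1) (hκ : κ ≤ 1 / 25) {x y : Plane}
    (hxy : x ≠ y) (h : IsAligned s κ s(x, y)) (h' : IsAligned s' κ s(x, y)) :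
    |s - s'| ≤ 5 * κ := by
  rw [isAligned_mk] at h h'
  have hd : 0 < dist x y := dist_pos.2 hxy
  have hsx : |s * (y 0 - x 0)| ≤ |y 0 - x 0| := by
    rw [abs_mul]; exact mul_le_of_le_one_left (abs_nonneg _) hs
  have hy : |y 1 - x 1| ≤ |y 0 - x 0| + κ * dist x y := by
    have := abs_add_le ((y 1 - x 1) - s * (y 0 - x 0)) (s * (y 0 - x 0))
    rw [sub_add_cancel] at this
    linarith
  have hdle : dist x y ≤ |y 0 - x 0| + |y 1 - x 1| := by
    refine le_of_sq_le_sq ?_ (by positivity)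
    rw [dist_sq_plane, add_sq, sq_abs, sq_abs]
    have : 0 ≤ 2 * |y 0 - x 0| * |y 1 - x 1| := by positivity
    linarith
  -- The edge is far from vertical, so the gap `(s - s') * (y 0 - x 0)` between its two deviations
  -- controls `s - s'`.
  have hx : 2 / 5 * dist x y ≤ |y 0 - x 0| := by
    have : κ * dist x y ≤ 1 / 25 * dist x y := by gcongr
    linarith
  have hdiff : |s - s'| * |y 0 - x 0| ≤ 2 * κ * dist x y := by
    rw [← abs_mul]
    have := abs_sub ((y 1 - x 1) - s' * (y 0 - x 0)) ((y 1 - x 1) - s * (y 0 - x 0))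
    rw [show (y 1 - x 1) - s' * (y 0 - x 0) - ((y 1 - x 1) - s * (y 0 - x 0)) =
      (s - s') * (y 0 - x 0) by ring] at this
    linarith
  have : |s - s'| * (2 / 5 * dist x y) ≤ 2 * κ * dist x y :=
    (mul_le_mul_of_nonneg_left hx (abs_nonneg _)).trans hdiff
  have : |s - s'| * dist x y ≤ (5 * κ) * dist x y := by linarith
  exact le_of_mul_le_mul_right this hd

/-! ### The ladder and its spanners -/

/-- A path through two vertical columns of points at spacing `δ`, one unit apart: down the first
column, which has `a` points, and then up the second one. -/
noncomputable def ladder (a : ℕ) (δ : ℝ) (k : ℕ) : Plane :=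
  if k < a then !₂[0, ((a : ℝ) - 1 - k) * δ] else !₂[1, ((k : ℝ) - a) * δ]

theorem ladder_injective (a : ℕ) {δ : ℝ} (hδ : 0 < δ) : Function.Injective (ladder a δ) := by
  intro k l h
  have h0 := congrArg (fun v : Plane => v 0) h
  have h1 := congrArg (fun v : Plane => v 1) h
  unfold ladder at h0 h1
  split_ifs at h0 h1
  · simp [hδ.ne'] at h1
    exact_mod_cast h1
  · simp at h0
  · simp at h0
  · simp [hδ.ne'] at h1
    exact_mod_cast h1

/-- The extra `1` pays for the single crossing, from `(0, 0)` to `(1, 0)`. -/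
theorem dist_ladder_succ_le (a : ℕ) {δ : ℝ} (hδ : 0 < δ) (k : ℕ) :
    dist (ladder a δ k) (ladder a δ (k + 1)) ≤ δ + if k = a - 1 then 1 else 0 := by
  refine le_of_sq_le_sq ?_ (by positivity)
  rw [dist_sq_plane]
  unfold ladder
  rcases lt_trichotomy (k + 1) a with h | h | h
  · rw [if_pos (by omega), if_pos (by omega), if_neg (by omega)]
    simp
    apply le_of_eq; ring
  · subst h
    rw [if_neg (by omega), if_pos (by omega), if_pos (by omega)]
    simp
    exact le_trans (by linarith) (le_abs_self _)
  · rw [if_neg (by omega), if_neg (by omega)]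
    have : (0 : ℝ) ≤ if k = a - 1 then 1 else 0 := by positivity
    simp
    nlinarith

theorem mstWeight_ladder_le [DecidableEq Plane] (a : ℕ) {δ : ℝ} (hδ : 0 < δ) {n : ℕ} (hn : 1 ≤ n) :
    mstWeight ((Finset.range n).image (ladder a δ)) ≤ ENNReal.ofReal (n * δ + 1) := by
  refine (mstWeight_image_le _ hn).trans ?_
  simp only [edist_dist]
  rw [← ENNReal.ofReal_sum_of_nonneg fun _ _ => dist_nonneg]
  refine ENNReal.ofReal_le_ofReal
    ((Finset.sum_le_sum fun k _ => dist_ladder_succ_le a hδ k).trans ?_)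
  rw [Finset.sum_add_distrib, Finset.sum_const, Finset.card_range, nsmul_eq_mul,
    Finset.sum_ite_eq']
  have h1 : ((n - 1 : ℕ) : ℝ) ≤ n := by exact_mod_cast Nat.sub_le n 1
  gcongr
  split_ifs <;> norm_num

theorem card_mul_le_of_disjoint {ι : Type*} {G : SimpleGraph Plane} (hG : G.edgeSet.Finite)
    (I : Finset ι) {w : ℝ≥0∞} (hw : w ≠ 0) (F : ι → Finset (Sym2 Plane))
    (hF : ∀ i ∈ I, (F i : Set (Sym2 Plane)) ⊆ G.edgeSet)
    (hsum : ∀ i ∈ I, w ≤ ∑ e ∈ F i, edgeLength e)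
    (hdisj : ∀ i ∈ I, ∀ j ∈ I, i ≠ j → Disjoint (F i) (F j)) :
    I.card ≤ G.edgeSet.ncard ∧ I.card * w ≤ weight G := by
  classical
  have hsub : ((I.biUnion F : Finset (Sym2 Plane)) : Set (Sym2 Plane)) ⊆ G.edgeSet := by
    intro e he
    obtain ⟨i, hi, he⟩ := Finset.mem_biUnion.1 he
    exact hF i hi he
  constructor
  · calc I.card = ∑ i ∈ I, 1 := by simp
      _ ≤ ∑ i ∈ I, (F i).card := Finset.sum_le_sum fun i hi => by
        rw [Nat.one_le_iff_ne_zero, Finset.card_ne_zero, Finset.nonempty_iff_ne_empty]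
        intro h
        have := hsum i hi
        rw [h, Finset.sum_empty] at this
        exact hw (le_antisymm this zero_le)
      _ = (I.biUnion F).card := (Finset.card_biUnion hdisj).symm
      _ = ((I.biUnion F : Finset (Sym2 Plane)) : Set (Sym2 Plane)).ncard :=
        (Set.ncard_coe_finset _).symm
      _ ≤ G.edgeSet.ncard := Set.ncard_le_ncard hsub hG
  · calc I.card * w = ∑ i ∈ I, w := by simp
      _ ≤ ∑ i ∈ I, ∑ e ∈ F i, edgeLength e := Finset.sum_le_sum hsum
      _ = ∑ e ∈ I.biUnion F, edgeLength e := (Finset.sum_biUnion hdisj).symm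
      _ ≤ weight G := sum_edgeLength_le_weight hsub

/-- In a Steiner spanner for a ladder, the edges that serve two different rungs of slope at most
`1` are different. -/
theorem ladder_spanner_bounds [DecidableEq Plane] {n m : ℕ} {ε : ℝ} (hm : 1 ≤ m) (hε : 0 < ε)
    (hmε : m * √ε ≤ 1 / 100) (hmn : m ≤ n / 2) {G : SimpleGraph Plane}
    (hG : IsSteinerSpanner ((Finset.range n).image (ladder (n - n / 2) (1 / m))) (1 + ε) G) :
    (n / 2 - m + 1) * m ≤ G.edgeSet.ncard ∧
      ((n / 2 - m + 1) * m : ℕ) * ENNReal.ofReal (1 / 2) ≤ weight G := by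
  have hm0 : (0 : ℝ) < m := by exact_mod_cast hm
  have hm1 : (1 : ℝ) ≤ m := by exact_mod_cast hm
  have hsε : 0 < √ε := Real.sqrt_pos.2 hε
  have hsε' : √ε ≤ 1 / 100 := (le_mul_of_one_le_left hsε.le hm1).trans hmε
  have hε' : ε ≤ 1 / 10000 := by
    have := (Real.sqrt_le_left (by norm_num)).1 hsε'
    norm_num at this ⊢
    linarith
  -- Rung `(i, t)` joins height `i / m` on the left to `(i + t) / m` on the right; the ranges ensure
  -- `i + t < n / 2`.
  have hex : ∀ q ∈ Finset.range (n / 2 - m + 1) ×ˢ Finset.range m,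
      ∃ F : Finset (Sym2 Plane), (F : Set (Sym2 Plane)) ⊆ G.edgeSet ∧
      ENNReal.ofReal (1 / 2) ≤ ∑ e ∈ F, edgeLength e ∧
      ∀ e ∈ F, IsAligned (q.2 * (1 / m)) (4 * √ε) e ∧
        ∀ v ∈ e, |v 1 - q.1 * (1 / m) - q.2 * (1 / m) * v 0| ≤ 3 * √ε := by
    rintro ⟨i, t⟩ hq
    simp only [Finset.mem_product, Finset.mem_range] at hq
    obtain ⟨hi, ht⟩ := hq
    have e1 : ladder (n - n / 2) (1 / m) (n - n / 2 - 1 - i) = !₂[0, i * (1 / m : ℝ)] := by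
      unfold ladder
      have h : ((n - n / 2 - 1 - i : ℕ) : ℝ) + 1 + i = (n - n / 2 : ℕ) := by
        exact_mod_cast (by omega)
      rw [if_pos (by omega), ← h]
      congr 3
      ring
    have e2 : ladder (n - n / 2) (1 / m) (n - n / 2 + (i + t)) =
        !₂[1, (i + t) * (1 / m : ℝ)] := by
      unfold ladder
      rw [if_neg (by omega)]
      congr 3
      push_cast
      ring
    have hs : |(t * (1 / m) : ℝ)| ≤ 1 := by
      rw [abs_of_nonneg (by positivity), mul_one_div, div_le_one hm0]
      exact_mod_cast ht.le
    obtain ⟨F, hF, hsum, hal⟩ := exists_aligned_edges hε hε' hs hG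
      (a := ladder (n - n / 2) (1 / m) (n - n / 2 - 1 - i))
      (b := ladder (n - n / 2) (1 / m) (n - n / 2 + (i + t)))
      (Finset.mem_image_of_mem _ (Finset.mem_range.2 (by omega)))
      (Finset.mem_image_of_mem _ (Finset.mem_range.2 (by omega)))
      (by rw [e1, e2]; simp) (by rw [e1, e2]; simp; ring)
    refine ⟨F, hF, hsum, fun e he => ⟨(hal e he).1, fun v hv => ?_⟩⟩
    have := (hal e he).2 v hv
    rw [e1] at this
    simpa using this
  choose! F hF hsum hal using hex
  have key := card_mul_le_of_disjoint hG.1 _ (by simp) F hF hsum ?_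
  · rwa [Finset.card_product, Finset.card_range, Finset.card_range] at key
  -- The spacing beats both `5 * (4 * √ε)`, the slope gap of a shared edge, and `2 * (3 * √ε)`, the
  -- height gap of two parallel strips that meet.
  have hspace : 100 * √ε ≤ 1 / m := by
    rw [le_div_iff₀ hm0]; linarith
  have hsep : ∀ k l : ℕ, |(k : ℝ) * (1 / m) - l * (1 / m)| < 1 / m → k = l := by
    intro k l h
    rw [← sub_mul, abs_mul, abs_of_pos (by positivity : (0 : ℝ) < 1 / m)] at h
    have h1 : |(k : ℝ) - l| < 1 := by
      by_contra! hc
      have := mul_le_mul_of_nonneg_right hc (by positivity : (0 : ℝ) ≤ 1 / m)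
      linarith
    have h2 : |(k : ℤ) - l| < 1 := by exact_mod_cast h1
    have := Int.abs_lt_one_iff.1 h2
    omega
  rintro ⟨i, t⟩ hq ⟨i', t'⟩ hq' hne
  rw [Finset.disjoint_left]
  intro e he he'
  obtain ⟨ha, hv⟩ := hal _ hq e he
  obtain ⟨ha', hv'⟩ := hal _ hq' e he'
  have hadj := hF _ hq he
  simp only [Finset.mem_product, Finset.mem_range] at hq
  induction e using Sym2.ind with
  | _ x y =>
  have hxy : x ≠ y := G.ne_of_adj hadj
  have hs : |(t * (1 / m) : ℝ)| ≤ 1 := by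
    rw [abs_of_nonneg (by positivity), mul_one_div, div_le_one hm0]
    exact_mod_cast hq.2.le
  have htt : t = t' := by
    refine hsep t t' ((abs_slope_sub_le hs (by linarith) hxy ha ha').trans_lt ?_)
    linarith
  subst htt
  refine hne (Prod.ext (hsep i i' ?_) rfl)
  have hx := hv x (Sym2.mem_mk_left x y)
  have hx' := hv' x (Sym2.mem_mk_left x y)
  simp only at hx hx'
  rw [abs_le] at hx hx'
  rw [abs_lt]
  constructor <;> linarith [hx.1, hx.2, hx'.1, hx'.2]

/-- If `m` is at most `1 / (100 √ε)`, there are `n` points for which every Steiner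
`(1 + ε)`-spanner has `Ω(n m)` edges and lightness `Ω(m ^ 2)`. -/
theorem exists_spanner_lower_bound {n m : ℕ} {ε : ℝ} (hn : 2 ≤ n) (hm : 1 ≤ m) (hε : 0 < ε)
    (hmε : m * √ε ≤ 1 / 100) (hmn : m ≤ (n / 2 + 1) / 2) :
    ∃ P : Finset Plane, P.card = n ∧ ∀ G : SimpleGraph Plane, IsSteinerSpanner P (1 + ε) G →
      (n : ℝ) * m / 4 ≤ G.edgeSet.ncard ∧
        ENNReal.ofReal ((m : ℝ) ^ 2 / 16) ≤ lightness P G := by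
  classical
  have hm0 : (0 : ℝ) < m := by exact_mod_cast hm
  refine ⟨(Finset.range n).image (ladder (n - n / 2) (1 / m)), ?_, fun G hG => ?_⟩
  · rw [Finset.card_image_of_injective _ (ladder_injective _ (by positivity)), Finset.card_range]
  obtain ⟨hE, hW⟩ := ladder_spanner_bounds hm hε hmε (by omega) hG
  -- By `hmn`, `m` takes at most half of `n / 2 + 1`, so at least `n / 4` starting heights remain.
  have hcount : (n : ℝ) * m / 4 ≤ ((n / 2 - m + 1) * m : ℕ) := by
    have : n * m ≤ 4 * ((n / 2 - m + 1) * m) := by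
      rw [← mul_assoc]
      exact Nat.mul_le_mul_right m (by omega)
    have : (n : ℝ) * m ≤ 4 * ((n / 2 - m + 1) * m : ℕ) := by exact_mod_cast this
    linarith
  refine ⟨hcount.trans (by exact_mod_cast hE), ?_⟩
  have hW' : ENNReal.ofReal ((n : ℝ) * m / 8) ≤ weight G := by
    refine le_trans ?_ hW
    rw [← ENNReal.ofReal_natCast, ← ENNReal.ofReal_mul (by positivity)]
    exact ENNReal.ofReal_le_ofReal (by linarith)
  have hM : mstWeight ((Finset.range n).image (ladder (n - n / 2) (1 / m))) ≤
      ENNReal.ofReal (2 * n / m) := by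
    refine (mstWeight_ladder_le _ (by positivity) (by omega)).trans (ENNReal.ofReal_le_ofReal ?_)
    have : (m : ℝ) ≤ n := by exact_mod_cast (by omega : m ≤ n)
    have : 1 ≤ (n : ℝ) / m := by rwa [one_le_div hm0]
    rw [mul_one_div, mul_div_assoc]
    linarith
  have hn0 : (0 : ℝ) < n := by exact_mod_cast (by omega : 0 < n)
  refine le_trans (le_of_eq ?_) (ENNReal.div_le_div hW' hM)
  rw [← ENNReal.ofReal_div_of_pos (by positivity)]
  congr 1
  field_simp
  norm_num

end EuclidSpanner

/-! ### Choice of the spacing -/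

theorem theorem4 :
    ∃ ε₀ : ℝ, 0 < ε₀ ∧ ε₀ < 1 ∧
      ∀ (k : ℕ) (K : ℝ), 1 ≤ k → 0 < K →
        ∃ c : ℝ, 0 < c ∧
          ∀ (n : ℕ) (ε : ℝ), 2 ≤ n → 0 < ε → ε ≤ ε₀ →
            K / (n : ℝ) ^ 2 ≤ ε * Real.log (1 / ε) ^ k →
            ∃ P : Finset EuclidSpanner.Plane, P.card = n ∧
              ∀ G : SimpleGraph EuclidSpanner.Plane,
                EuclidSpanner.IsSteinerSpanner P (1 + ε) G →
                  c * ((n : ℝ) / Real.sqrt (ε * Real.log (1 / ε) ^ k)) ≤ (G.edgeSet.ncard : ℝ) ∧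
                  ENNReal.ofReal (c * (1 / (ε * Real.log (1 / ε) ^ k))) ≤
                    EuclidSpanner.lightness P G := by
  refine ⟨1 / 10000, by norm_num, by norm_num, fun k K _ hK => ?_⟩
  -- The two terms match the two caps on `m` below: the number of points and the separation of
  -- rungs.
  obtain ⟨c, hc⟩ : ∃ c, c = min (√K / 8) (1 / 200) := ⟨_, rfl⟩
  have hc0 : 0 < c := by rw [hc]; positivity
  refine ⟨min (c / 4) (c ^ 2 / 16), by positivity, fun n ε hn hε hε' hnε => ?_⟩
  have hlog : 1 ≤ Real.log (1 / ε) := by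
    rw [Real.le_log_iff_exp_le (by positivity), le_div_iff₀ hε]
    have := Real.exp_one_lt_d9
    nlinarith
  obtain ⟨δ, hδ⟩ : ∃ δ, δ = ε * Real.log (1 / ε) ^ k := ⟨_, rfl⟩
  rw [← hδ] at hnε ⊢
  -- The logarithm enters the construction only through `ε ≤ δ`.
  have hεδ : ε ≤ δ := by rw [hδ]; exact le_mul_of_one_le_right hε.le (one_le_pow₀ hlog)
  have hδ0 : 0 < δ := hε.trans_le hεδ
  obtain ⟨D, hD⟩ : ∃ D, D = √δ := ⟨_, rfl⟩
  have hD0 : 0 < D := by rw [hD]; exact Real.sqrt_pos.2 hδ0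
  have hD2 : δ = D ^ 2 := by rw [hD, Real.sq_sqrt hδ0.le]
  have hsD : √ε ≤ D := by rw [hD]; exact Real.sqrt_le_sqrt hεδ
  have hsε : √ε ≤ 1 / 100 := by
    rw [Real.sqrt_le_left (by norm_num)]; norm_num at hε' ⊢; linarith
  have hn0 : (0 : ℝ) < n := by exact_mod_cast (by omega : 0 < n)
  have hKn : √K ≤ n * D := by
    rw [div_le_iff₀ (by positivity), hD2, ← mul_pow] at hnε
    rw [Real.sqrt_le_left (by positivity), mul_comm]
    exact hnε
  -- `m` is of order `1 / √δ` rather than `1 / √ε`, because `hKn` only guarantees that `n` is at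
  -- least of order `1 / √δ`. The value `1` is always admissible since `√ε ≤ 1 / 100`.
  obtain ⟨m, hm⟩ : ∃ m, m = min ((n / 2 + 1) / 2) (max 1 ⌊1 / (100 * D)⌋₊) := ⟨_, rfl⟩
  have hm1 : 1 ≤ m := by
    rw [hm]; exact le_min (by omega) (le_max_left _ _)
  have hmε : m * √ε ≤ 1 / 100 := by
    have : m ≤ max 1 ⌊1 / (100 * D)⌋₊ := hm ▸ min_le_right _ _
    rcases le_max_iff.1 this with h | h
    · have h' : (m : ℝ) ≤ 1 := by exact_mod_cast h
      exact (mul_le_of_le_one_left (Real.sqrt_nonneg _) h').trans hsε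
    · have h' : (m : ℝ) ≤ 1 / (100 * D) :=
        (Nat.cast_le.2 h).trans (Nat.floor_le (by positivity))
      calc m * √ε ≤ 1 / (100 * D) * D := by gcongr
        _ = 1 / 100 := by field_simp
  have hmD : c ≤ m * D := by
    rcases min_choice ((n / 2 + 1) / 2) (max 1 ⌊1 / (100 * D)⌋₊) with h | h
    · rw [h] at hm
      have h1 : (n : ℝ) ≤ 8 * m := by exact_mod_cast (by omega : n ≤ 8 * m)
      have h2 : (n : ℝ) * D ≤ 8 * m * D := by gcongr
      have h3 : c ≤ √K / 8 := hc ▸ min_le_left _ _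
      linarith
    · rw [h] at hm
      have h1 : 1 / (100 * D) ≤ 2 * m := by
        have h2 := Nat.lt_floor_add_one (1 / (100 * D))
        have h3 : (⌊1 / (100 * D)⌋₊ : ℝ) ≤ m := by exact_mod_cast hm ▸ le_max_right _ _
        have h4 : (1 : ℝ) ≤ m := by exact_mod_cast hm1
        linarith
      have h3 : c ≤ 1 / 200 := hc ▸ min_le_right _ _
      rw [div_le_iff₀ (by positivity)] at h1
      linarith
  obtain ⟨P, hP, hPG⟩ :=
    EuclidSpanner.exists_spanner_lower_bound hn hm1 hε hmε (hm ▸ min_le_left _ _)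
  refine ⟨P, hP, fun G hG => ?_⟩
  obtain ⟨hE, hL⟩ := hPG G hG
  refine ⟨le_trans ?_ hE, (ENNReal.ofReal_le_ofReal ?_).trans hL⟩
  · rw [← hD, mul_div_assoc', div_le_iff₀ hD0]
    have h1 : min (c / 4) (c ^ 2 / 16) * n ≤ c / 4 * n := by
      gcongr; exact min_le_left _ _
    have h2 : n * c ≤ n * (m * D) := by gcongr
    linarith
  · rw [hD2, mul_one_div, div_le_iff₀ (by positivity)]
    have h1 : c ^ 2 ≤ (m * D) ^ 2 := pow_le_pow_left₀ hc0.le hmD 2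
    have h2 : min (c / 4) (c ^ 2 / 16) ≤ c ^ 2 / 16 := min_le_right _ _
    rw [mul_pow] at h1
    linarith
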